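/- Let $(V,Y,\mathbf 1)$ be a vertex algebra over $\mathbb C$, with $Y(u,z)=\sum_{n\in\mathbb Z}u_nz^{-n-1}$, equipped with a $\mathbb C$-grading $V=\bigoplus_{\lambda\in\mathbb C}V_\lambda$ such that $\mathbf 1\in V_0$ and $v_nV_\lambda\subseteq V_{\lambda+\gamma-n-1}$ for $v\in V_\gamma$, $n\in\mathbb Z$; write $|v|=\gamma$ for $v\in V_\gamma$. Let $\Omega(V)$ be the set of $v\in V$ such that for all $\gamma\in\mathbb C$, $u\in V_\gamma$ and $n\in\mathbb Z$, $u_nv\neq0$ implies $n=\gamma-1$ or $n<\mathrm{Re}(\gamma)-1$. Assume that $V$ is an $\Omega$-generated $\mathbb C_{Re>0}$-graded vertex algebra, that is: (a) $V$ is spanned by the vectors $v^k_{n_k}\cdots v^1_{n_1}u^0$ with $k\ge 0$, $v^j\in V$, $n_j\in\mathbb Z$, $u^0\in\Omega(V)$; (b) the degree $\deg(v^k_{n_k}\cdots v^1_{n_1}u^0)=\sum_{j=1}^k(|v^j|-n_j-1)$ ($v^j$ homogeneous, $u^0\in\Omega(V)$) is well defined, that is, the subspaces $V(d)$, $d\in\mathbb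 C$, spanned by all such expressions with $\sum_j(|v^j|-n_j-1)=d$ are linearly independent. For $r\in\mathbb C$ let $V^r$ be the span of the homogeneous $v\in V$ with $|v|-\lceil\mathrm{Re}|v|\rceil=r$, so that $V^0$ is the integer-graded part of $V$. Assume that $V^0=\bigoplus_{n=0}^\infty V_n$. For homogeneous $u\in V^r$ and $v\in V$ put $$u\circ v=\mathrm{Res}_z\frac{(1+z)^{\lceil \mathrm{Re}|u|\rceil+\delta_{r,0}-1}}{z^{1+\delta_{r,0}}}Y(u,z)v,$$ extended linearly in $u$; let $O(V)$ be the span of all $u\circ v$, $u,v\in V$, and let $A(V)=V/O(V)$ (the Zhu algebra of $V$), with $[u]=u+O(V)$. For $t\geq -1$ let $F_tA(V)$ be the image of $\bigoplus_{j=0}^tV_j$ in $A(V)$ (so $F_{-1}A(V)=0$), and let $grA(V)=\bigoplus_{t\ge0}F_tA(V)/F_{t-1}A(V)$. Let $f:V\to grA(V)$ be the linear map with $f(u)=[u]+F_{k-1}A(V)$ for $u\in V_k$, $k\in\mathbb N$, and $f(u)=0$ for $u\in V_\lambda$, $\lambda\notin\mathbb N$. Finally let $$C(V)=\mathrm{Span}_{\mathbb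 C}\{a,\ u_{-2}v,\ b_{-1}w \mid a,b\in V^r \text{ with } r\neq0,\ u\in V^0,\ v,w\in V\}.$$ Then $f$ is surjective and $C(V)\subseteq\ker f$. Hence $f$ induces a linear epimorphism $\bar f:V/C(V)\to grA(V)$, and $\dim A(V)\le\dim V/C(V)$ (as cardinals). -/

import Mathlib

open scoped DirectSum

noncomputable section

/-- A vertex algebra over `ℂ` on the vector space `V`.  Mathlib's `VertexOperator ℂ V` is the space
of linear maps `V → V((x))`, so the lower truncation condition is part of the type of `Y`; the mode
`u_n`, the coefficient of `x^{-n-1}` in `Y(u, x)`, is `VertexOperator.ncoeff (Y u) n`. -/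
structure VertexAlgebra (V : Type*) [AddCommGroup V] [Module ℂ V] where
  /-- The state-field correspondence. -/
  Y : V →ₗ[ℂ] VertexOperator ℂ V
  /-- The vacuum vector. -/
  vac : V
  /-- `Y(𝟏, x)` is the identity. -/
  vacuum : ∀ (n : ℤ) (v : V),
    VertexOperator.ncoeff (Y vac) n v = if n = -1 then v else 0
  /-- `Y(v, x)𝟏` has no negative powers of `x`. -/
  creation_nonneg : ∀ (v : V) (n : ℤ), 0 ≤ n → VertexOperator.ncoeff (Y v) n vac = 0
  /-- The constant term of `Y(v, x)𝟏` is `v`. -/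
  creation_neg_one : ∀ v : V, VertexOperator.ncoeff (Y v) (-1) vac = v
  /-- The Jacobi identity: equality of the coefficients of `x₀^{-l-1} x₁^{-m-1} x₂^{-n-1}`,
  applied to `w`.  All sums are finite by lower truncation. -/
  jacobi : ∀ (u v w : V) (l m n : ℤ),
    (∑ᶠ i : ℕ, ((-1 : ℤ) ^ i * Ring.choose l i) •
        VertexOperator.ncoeff (Y u) (l + m - i) (VertexOperator.ncoeff (Y v) (n + i) w)) -
      (∑ᶠ i : ℕ, ((l.negOnePow : ℤ) * (-1 : ℤ) ^ i * Ring.choose l i) •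
        VertexOperator.ncoeff (Y v) (l + n - i) (VertexOperator.ncoeff (Y u) (m + i) w)) =
    ∑ᶠ i : ℕ, Ring.choose m i •
        VertexOperator.ncoeff (Y (VertexOperator.ncoeff (Y u) (l + i) v)) (m + n - i) w

/-- The mode `u_n` of a vertex algebra. -/
def VertexAlgebra.mode {V : Type*} [AddCommGroup V] [Module ℂ V] (A : VertexAlgebra V)
    (u : V) (n : ℤ) : Module.End ℂ V :=
  VertexOperator.ncoeff (A.Y u) n

/-- A `ℂ`-graded vertex algebra: `V = ⨁_{γ ∈ ℂ} V_γ` with `𝟏 ∈ V_0` and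
`v_n V_γ ⊆ V_{γ + |v| - n - 1}` for homogeneous `v`. -/
structure CGradedVertexAlgebra (V : Type*) [AddCommGroup V] [Module ℂ V] extends
    VertexAlgebra V where
  /-- `weight γ` is the homogeneous component `V_γ`. -/
  weight : ℂ → Submodule ℂ V
  isInternal : DirectSum.IsInternal weight
  vac_mem : vac ∈ weight 0
  mode_mem : ∀ (γ δ : ℂ) (v w : V) (n : ℤ), v ∈ weight γ → w ∈ weight δ →
    toVertexAlgebra.mode v n w ∈ weight (δ + γ - n - 1)

namespace CGradedVertexAlgebra

variable {V : Type*} [AddCommGroup V] [Module ℂ V] (A : CGradedVertexAlgebra V)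

/-- The linear isomorphism `V ≃ ⨁_γ V_γ`. -/
def decomp : V ≃ₗ[ℂ] ⨁ γ : ℂ, A.weight γ :=
  (LinearEquiv.ofBijective (DirectSum.coeLinearMap A.weight) A.isInternal).symm

/-- `Ω(V)`: the vectors killed by every mode `u_n`, `u ∈ V_γ`, except possibly those with
`n = γ - 1` or `n < Re γ - 1`. -/
def Omega : Set V :=
  {v | ∀ (γ : ℂ) (u : V) (n : ℤ), u ∈ A.weight γ → A.mode u n v ≠ 0 →
    (n : ℂ) = γ - 1 ∨ (n : ℝ) < γ.re - 1}

/-- Vectors of the form `v^k_{n_k} ⋯ v^1_{n_1} u⁰`, with `k ≥ 0` and `u⁰ ∈ Ω(V)`. -/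
inductive IsOmegaMonomial : V → Prop
  | base (u : V) (hu : u ∈ A.Omega) : IsOmegaMonomial u
  | step (v : V) (n : ℤ) (x : V) (hx : IsOmegaMonomial x) : IsOmegaMonomial (A.mode v n x)

/-- `V` is `Ω`-generated: every vector is a finite sum of vectors
`v^k_{n_k} ⋯ v^1_{n_1} u⁰`, `u⁰ ∈ Ω(V)`. -/
def IsOmegaGenerated : Prop :=
  Submodule.span ℂ {v | A.IsOmegaMonomial v} = ⊤

/-- `HasDegree d x`: `x = v^k_{n_k} ⋯ v^1_{n_1} u⁰` for some homogeneous `v^j` and some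
`u⁰ ∈ Ω(V)`, with `d = ∑_j (|v^j| - n_j - 1)`. -/
inductive HasDegree : ℂ → V → Prop
  | base (u : V) (hu : u ∈ A.Omega) : HasDegree 0 u
  | step (γ : ℂ) (v : V) (hv : v ∈ A.weight γ) (n : ℤ) (d : ℂ) (x : V) (hx : HasDegree d x) :
      HasDegree (d + (γ - n - 1)) (A.mode v n x)

/-- `V(d)`: the span of all expressions `v^k_{n_k} ⋯ v^1_{n_1} u⁰` of degree `d`. -/
def degreeSpace (d : ℂ) : Submodule ℂ V :=
  Submodule.span ℂ {x | A.HasDegree d x}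

/-- An `Ω`-generated `ℂ_{Re>0}`-graded vertex algebra: `V` is `Ω`-generated, and the degree is
well defined, that is, the spaces `V(d)` are linearly independent. -/
structure IsOmegaGeneratedRePos : Prop where
  generated : A.IsOmegaGenerated
  degree_wellDefined : iSupIndep A.degreeSpace

/-- `γ - ⌈Re γ⌉`, which is `0` if and only if `γ` is an integer. -/
def weightClass (γ : ℂ) : ℂ := γ - (⌈γ.re⌉ : ℤ)

/-- `V^r`: the span of the homogeneous vectors `v` with `|v| - ⌈Re |v|⌉ = r`. -/
def classSpace (r : ℂ) : Submodule ℂ V :=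
  Submodule.span ℂ {v | ∃ γ : ℂ, v ∈ A.weight γ ∧ weightClass γ = r}

/-- `Res_z (1+z)^N z^{-m} Y(u,z)v = ∑_{j ≥ 0} (N choose j) u_{j-m} v`, a finite sum. -/
def residue (N m : ℤ) (u v : V) : V :=
  ∑ᶠ j : ℕ, Ring.choose N j • A.mode u (j - m) v

open Classical in
/-- `δ_{r,0}` for `r` the class of `γ`. -/
def classDelta (γ : ℂ) : ℤ := if weightClass γ = 0 then 1 else 0

/-- `u ∘ v`, given for `u ∈ V_γ` by
`Res_z (1+z)^{⌈Re γ⌉ + δ_{r,0} - 1} z^{-1-δ_{r,0}} Y(u,z)v` and extended linearly in `u`. -/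
def circ (u v : V) : V :=
  ∑ᶠ γ : ℂ, A.residue (⌈γ.re⌉ + classDelta γ - 1) (1 + classDelta γ) (A.decomp u γ : V) v

/-- `O(V)`: the span of all `u ∘ v`. -/
def O : Submodule ℂ V :=
  Submodule.span ℂ {x | ∃ u v : V, x = A.circ u v}

/-- The vector space `A(V) = V / O(V)` underlying the Zhu algebra. -/
abbrev Zhu : Type _ := V ⧸ A.O

/-- `F_t A(V)`, the image of `⨁_{0 ≤ j ≤ t} V_j` in `A(V)`; it is zero for `t < 0`. -/
def filtration (t : ℤ) : Submodule ℂ A.Zhu :=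
  (⨆ (j : ℕ) (_ : (j : ℤ) ≤ t), A.weight (j : ℂ)).map A.O.mkQ

/-- `gr_t A(V) = F_t A(V) / F_{t-1} A(V)`. -/
abbrev gr (t : ℕ) : Type _ :=
  A.filtration t ⧸ (A.filtration ((t : ℤ) - 1)).submoduleOf (A.filtration t)

/-- `gr A(V) = ⨁_{t ≥ 0} gr_t A(V)`. -/
abbrev grZhu : Type _ := ⨁ t : ℕ, A.gr t

theorem mkQ_mem_filtration (k : ℕ) (u : V) (hu : u ∈ A.weight (k : ℂ)) :
    A.O.mkQ u ∈ A.filtration k :=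
  Submodule.mem_map_of_mem
    ((le_iSup₂_of_le (f := fun (j : ℕ) (_ : (j : ℤ) ≤ k) => A.weight (j : ℂ)) k le_rfl le_rfl) hu)

/-- The map `V_k → gr_k A(V)`, `u ↦ [u] + F_{k-1} A(V)`. -/
def symbol (k : ℕ) : A.weight (k : ℂ) →ₗ[ℂ] A.gr k :=
  ((A.filtration ((k : ℤ) - 1)).submoduleOf (A.filtration k)).mkQ ∘ₗ
    (A.O.mkQ ∘ₗ (A.weight (k : ℂ)).subtype).codRestrict (A.filtration k)
      (fun u => A.mkQ_mem_filtration k u u.2)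

open Classical in
/-- The restriction of `f` to `V_γ`: `u ↦ [u] + F_{k-1} A(V)` if `γ = k` is a natural number,
and zero otherwise. -/
def fWeight (γ : ℂ) : A.weight γ →ₗ[ℂ] A.grZhu :=
  if h : ∃ k : ℕ, γ = (k : ℂ) then
    DirectSum.lof ℂ ℕ A.gr h.choose ∘ₗ A.symbol h.choose ∘ₗ
      Submodule.inclusion (le_of_eq (congrArg A.weight h.choose_spec))
  else 0

/-- The natural linear map `f : V → gr A(V)`. -/
def f : V →ₗ[ℂ] A.grZhu :=
  DirectSum.toModule ℂ ℂ A.grZhu A.fWeight ∘ₗ A.decomp.toLinearMap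

/-- `C(V)`: the span of all `a`, `u_{-2} v` and `b_{-1} w` with `a, b ∈ V^r` for some `r ≠ 0`,
`u ∈ V^0` and `v, w ∈ V`. -/
def C : Submodule ℂ V :=
  Submodule.span ℂ
    ({a | ∃ r : ℂ, r ≠ 0 ∧ a ∈ A.classSpace r} ∪
      {x | ∃ u v : V, u ∈ A.classSpace 0 ∧ x = A.mode u (-2) v} ∪
      {x | ∃ (r : ℂ) (b w : V), r ≠ 0 ∧ b ∈ A.classSpace r ∧ x = A.mode b (-1) w})

end CGradedVertexAlgebra

end

namespace CGradedVertexAlgebra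

variable {V : Type*} [AddCommGroup V] [Module ℂ V] (A : CGradedVertexAlgebra V)

/-! For homogeneous `u`, `u ∘ v` has leading term `u_{-1-δ} v`, where `δ = 1` for integral `|u|` and
`δ = 0` otherwise. Its other terms are modes `u_n v` with `n > -1-δ`, whose weights are smaller by
positive integers. If the leading term has weight `k ∈ ℕ`, its class therefore lies in `F_{k-1}
A(V)`, because negative integer weights do not occur; so `f` kills it (`f_mode`). The two values of
`δ` give the generators `u_{-2} v` and `b_{-1} w` of `C(V)`; the generators `a` have non-integral
weights, where `f` is zero by definition. Surjectivity holds because `V_k` maps onto `gr_k A(V)`.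
For the dimension bound, the filtration exhausts `A(V)`, since vectors of non-integral weight lie in
`O(V)` (`weight_le_O`). Splitting it linearly makes `A(V)` a quotient of `gr A(V)`, hence of `V /
C(V)`. -/

theorem weightClass_intCast (n : ℤ) : weightClass (n : ℂ) = 0 := by
  simp [weightClass]

theorem weightClass_eq_zero_iff (γ : ℂ) : weightClass γ = 0 ↔ ∃ n : ℤ, γ = n := by
  constructor
  · intro h
    exact ⟨⌈γ.re⌉, sub_eq_zero.mp h⟩
  · rintro ⟨n, rfl⟩
    exact weightClass_intCast n

theorem weightClass_natCast (n : ℕ) : weightClass (n : ℂ) = 0 :=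
  (weightClass_eq_zero_iff _).2 ⟨n, by simp⟩

theorem decomp_coe {γ : ℂ} (u : A.weight γ) :
    A.decomp (u : V) = DirectSum.lof ℂ ℂ (fun γ => A.weight γ) γ u := by
  rw [decomp, LinearEquiv.symm_apply_eq]
  exact (DirectSum.coeLinearMap_lof A.weight γ u).symm

theorem f_of_mem_weight_natCast {k : ℕ} {u : V} (hu : u ∈ A.weight (k : ℂ)) :
    A.f u = DirectSum.lof ℂ ℕ A.gr k (A.symbol k ⟨u, hu⟩) := by
  have h : ∃ j : ℕ, (k : ℂ) = (j : ℂ) := ⟨k, rfl⟩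
  -- The index chosen in `fWeight` equals `k` only propositionally; generalizing it to `j` permits
  -- substitution in the dependent types.
  have key : ∀ (j : ℕ) (hj : (k : ℂ) = (j : ℂ)),
      DirectSum.lof ℂ ℕ A.gr j (A.symbol j
        (Submodule.inclusion (le_of_eq (congrArg A.weight hj)) ⟨u, hu⟩)) =
      DirectSum.lof ℂ ℕ A.gr k (A.symbol k ⟨u, hu⟩) := by
    intro j hj
    obtain rfl : k = j := by exact_mod_cast hj
    rfl
  have h1 : A.decomp u = DirectSum.lof ℂ ℂ (fun γ => A.weight γ) k ⟨u, hu⟩ :=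
    A.decomp_coe ⟨u, hu⟩
  rw [f, LinearMap.comp_apply, LinearEquiv.coe_coe, h1, DirectSum.toModule_lof, fWeight,
    dif_pos h]
  exact key _ h.choose_spec

theorem f_eq_zero_of_forall_ne_natCast {γ : ℂ} (hγ : ∀ k : ℕ, γ ≠ k) {u : V}
    (hu : u ∈ A.weight γ) : A.f u = 0 := by
  have h1 : A.decomp u = DirectSum.lof ℂ ℂ (fun γ => A.weight γ) γ ⟨u, hu⟩ :=
    A.decomp_coe ⟨u, hu⟩
  rw [f, LinearMap.comp_apply, LinearEquiv.coe_coe, h1, DirectSum.toModule_lof, fWeight,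
    dif_neg (by simpa using hγ), LinearMap.zero_apply]

theorem f_eq_zero_of_mkQ_mem_filtration {k : ℕ} {u : V} (hu : u ∈ A.weight (k : ℂ))
    (h : A.O.mkQ u ∈ A.filtration ((k : ℤ) - 1)) : A.f u = 0 := by
  have : A.symbol k ⟨u, hu⟩ = 0 :=
    (Submodule.Quotient.mk_eq_zero _).2 h
  rw [A.f_of_mem_weight_natCast hu, this, map_zero]

/-! ### Surjectivity of `f` -/

/-- Modulo `F_{k-1} A(V)`, every element of `F_k A(V)` is the class of a vector of weight `k`. -/
theorem exists_weight_sub_mem_filtration {k : ℕ} {x : A.Zhu} (hx : x ∈ A.filtration k) :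
    ∃ u ∈ A.weight (k : ℂ), x - A.O.mkQ u ∈ A.filtration ((k : ℤ) - 1) := by
  have hle : A.filtration k ≤ (A.weight (k : ℂ)).map A.O.mkQ ⊔ A.filtration ((k : ℤ) - 1) := by
    rw [filtration, filtration, ← Submodule.map_sup]
    refine Submodule.map_mono (iSup₂_le fun j hj => ?_)
    rcases eq_or_lt_of_le (Int.ofNat_le.mp hj) with rfl | hlt
    · exact le_sup_left
    · refine le_sup_of_le_right (le_iSup₂_of_le (f := fun (j : ℕ) (_ : (j : ℤ) ≤ (k : ℤ) - 1) =>
        A.weight (j : ℂ)) j (by omega) le_rfl)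
  obtain ⟨_, ⟨u, hu, rfl⟩, z, hz, rfl⟩ := Submodule.mem_sup.mp (hle hx)
  exact ⟨u, hu, by simpa using hz⟩

theorem symbol_surjective (k : ℕ) : Function.Surjective (A.symbol k) := by
  intro y
  obtain ⟨⟨x, hx⟩, rfl⟩ := Submodule.mkQ_surjective _ y
  obtain ⟨u, hu, hxu⟩ := A.exists_weight_sub_mem_filtration hx
  refine ⟨⟨u, hu⟩, ((Submodule.Quotient.eq _).2 ?_).symm⟩
  exact hxu

theorem f_surjective : Function.Surjective A.f := by
  intro x
  induction x using DirectSum.induction_on with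
  | zero => exact ⟨0, map_zero _⟩
  | of k y =>
    obtain ⟨u, rfl⟩ := A.symbol_surjective k y
    exact ⟨u, A.f_of_mem_weight_natCast u.2⟩
  | add x y hx hy =>
    obtain ⟨u, rfl⟩ := hx
    obtain ⟨v, rfl⟩ := hy
    exact ⟨u + v, map_add _ _ _⟩

/-! ### Leading term of the residue -/

theorem mode_zero_left (n : ℤ) : A.mode 0 n = 0 := by
  simp [VertexAlgebra.mode]

theorem residue_zero_left (N m : ℤ) (v : V) : A.residue N m 0 v = 0 := by
  simp [residue, mode_zero_left]

theorem circ_of_mem_weight {γ : ℂ} {u : V} (hu : u ∈ A.weight γ) (v : V) :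
    A.circ u v = A.residue (⌈γ.re⌉ + classDelta γ - 1) (1 + classDelta γ) u v := by
  have h1 : A.decomp u = DirectSum.lof ℂ ℂ (fun γ => A.weight γ) γ ⟨u, hu⟩ :=
    A.decomp_coe ⟨u, hu⟩
  rw [circ, finsum_eq_single _ γ, h1, DirectSum.lof_apply]
  intro δ hδ
  rw [h1, DirectSum.lof_eq_of, DirectSum.of_eq_of_ne _ _ _ hδ, Submodule.coe_zero,
    residue_zero_left]

theorem exists_mode_eq_zero (u v : V) : ∃ N : ℤ, ∀ n : ℤ, N ≤ n → A.mode u n v = 0 := by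
  refine ⟨-HahnSeries.order ((HahnModule.of ℂ).symm (A.Y u v)), fun n hn => ?_⟩
  exact VertexOperator.ncoeff_eq_zero_of_lt_order _ _ _ (by omega)

theorem residue_support_finite (N m : ℤ) (u v : V) :
    (Function.support fun j : ℕ => Ring.choose N j • A.mode u (j - m) v).Finite := by
  obtain ⟨M, hM⟩ := A.exists_mode_eq_zero u v
  refine (Set.finite_Iio (M + m).toNat).subset fun j hj => ?_
  by_contra hlt
  refine hj ?_
  simp only [Set.mem_Iio, not_lt] at hlt
  simp only [hM (j - m) (by omega), smul_zero]

/-- The residue `Res_z (1+z)^N z^{-m} Y(u,z)v` is `u_{-m} v` up to the modes `u_n v`, `n > -m`. -/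
theorem residue_sub_mode_mem {S : Submodule ℂ V} (N m : ℤ) (u v : V)
    (hS : ∀ n : ℤ, -m < n → A.mode u n v ∈ S) :
    A.residue N m u v - A.mode u (-m) v ∈ S := by
  classical
  -- Inserting `0` lets the leading term be split off even when it vanishes.
  set s := insert 0 (A.residue_support_finite N m u v).toFinset with hs
  have hsum : A.residue N m u v = ∑ j ∈ s, Ring.choose N j • A.mode u (j - m) v := by
    refine finsum_eq_sum_of_support_subset _ fun j hj => ?_
    simp only [hs, Finset.coe_insert, Set.Finite.coe_toFinset]
    exact Or.inr hj
  rw [hsum, ← Finset.add_sum_erase s _ (Finset.mem_insert_self 0 _)]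
  simp only [Ring.choose_zero_right, one_smul, Nat.cast_zero, zero_sub, add_sub_cancel_left]
  refine S.sum_mem fun j hj => zsmul_mem (hS _ ?_) _
  have := Finset.ne_of_mem_erase hj
  omega

/-! ### Vanishing of `f` on `C(V)` -/

theorem weight_le_classSpace (γ : ℂ) : A.weight γ ≤ A.classSpace (weightClass γ) :=
  fun _ hv => Submodule.subset_span ⟨γ, hv, rfl⟩

theorem iSup_weight : ⨆ γ, A.weight γ = ⊤ :=
  A.isInternal.submodule_iSup_eq_top

/-- If the integer-graded part of `V` is `⨁_{n ≥ 0} V_n`, there is nothing in negative integer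
weights. -/
theorem weight_intCast_eq_bot (h0 : A.classSpace 0 = ⨆ n : ℕ, A.weight (n : ℂ)) {m : ℤ}
    (hm : m < 0) : A.weight (m : ℂ) = ⊥ := by
  have h1 : A.weight (m : ℂ) ≤ ⨆ (δ : ℂ) (_ : δ ≠ m), A.weight δ := by
    have h2 := A.weight_le_classSpace m
    rw [weightClass_intCast, h0] at h2
    refine h2.trans (iSup_le fun n => le_iSup₂_of_le (n : ℂ) ?_ le_rfl)
    intro h
    have : (n : ℤ) = m := by exact_mod_cast h
    omega
  exact le_bot_iff.mp ((A.isInternal.submodule_iSupIndep (m : ℂ)).le_bot.trans' (le_inf le_rfl h1))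

theorem weight_intCast_le_iSup (h0 : A.classSpace 0 = ⨆ n : ℕ, A.weight (n : ℂ)) {m t : ℤ}
    (hmt : m ≤ t) : A.weight (m : ℂ) ≤ ⨆ (j : ℕ) (_ : (j : ℤ) ≤ t), A.weight (j : ℂ) := by
  rcases lt_or_ge m 0 with hm | hm
  · rw [A.weight_intCast_eq_bot h0 hm]
    exact bot_le
  · lift m to ℕ using hm
    rw [Int.cast_natCast]
    exact le_iSup₂_of_le (f := fun (j : ℕ) (_ : (j : ℤ) ≤ t) => A.weight (j : ℂ)) m hmt le_rfl

/-- For homogeneous `u` and `v` with `u_{-1-δ} v` of natural weight `k`, the relation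
`u ∘ v ∈ O(V)` expresses `u_{-1-δ} v` through vectors of lower weight. -/
theorem f_mode_of_mem_weight (h0 : A.classSpace 0 = ⨆ n : ℕ, A.weight (n : ℂ)) {γ δ : ℂ}
    {u v : V} (hu : u ∈ A.weight γ) (hv : v ∈ A.weight δ) :
    A.f (A.mode u (-(1 + classDelta γ)) v) = 0 := by
  set m := 1 + classDelta γ with hm
  have hmem := A.mode_mem γ δ u v (-m) hu hv
  by_cases hk : ∃ k : ℕ, δ + γ - ((-m : ℤ) : ℂ) - 1 = k
  · obtain ⟨k, hk⟩ := hk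
    rw [hk] at hmem
    refine A.f_eq_zero_of_mkQ_mem_filtration hmem ?_
    have hO : A.circ u v ∈ A.O := Submodule.subset_span ⟨u, v, rfl⟩
    have hlow := A.residue_sub_mode_mem
      (S := ⨆ (j : ℕ) (_ : (j : ℤ) ≤ (k : ℤ) - 1), A.weight (j : ℂ))
      (⌈γ.re⌉ + classDelta γ - 1) m u v fun n hn => by
        -- The weight `k - m - n` of `u_n v` is at most `k - 1` since `n > -m`; it may be negative,
        -- and then the weight space is zero.
        refine A.weight_intCast_le_iSup h0 (m := k - m - n) (by omega) ?_
        have h := A.mode_mem γ δ u v n hu hv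
        convert h using 2
        push_cast at hk ⊢
        linear_combination -hk
    rw [← A.circ_of_mem_weight hu] at hlow
    have := Submodule.mem_map_of_mem (f := A.O.mkQ) hlow
    have hzero : A.O.mkQ (A.circ u v) = 0 := (Submodule.Quotient.mk_eq_zero A.O).2 hO
    rwa [map_sub, hzero, zero_sub, neg_mem_iff] at this
  · push Not at hk
    exact A.f_eq_zero_of_forall_ne_natCast hk hmem

/-- Linearity removes homogeneity only from `v`: the mode index depends on the class of `|u|`. -/
theorem f_mode (h0 : A.classSpace 0 = ⨆ n : ℕ, A.weight (n : ℂ)) {γ : ℂ} {u : V}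
    (hu : u ∈ A.weight γ) (v : V) : A.f (A.mode u (-(1 + classDelta γ)) v) = 0 := by
  have : (⊤ : Submodule ℂ V) ≤ LinearMap.ker (A.f ∘ₗ A.mode u (-(1 + classDelta γ))) := by
    rw [← A.iSup_weight]
    exact iSup_le fun δ v hv => A.f_mode_of_mem_weight h0 hu hv
  exact this (Submodule.mem_top (x := v))

/-- A linear condition on `u` holds on `V^r` if it holds for homogeneous vectors of class `r`. -/
theorem classSpace_le_ker_mode {W : Type*} [AddCommMonoid W] [Module ℂ W] (g : V →ₗ[ℂ] W) (r : ℂ)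
    (n : ℤ) (v : V)
    (h : ∀ (γ : ℂ) (u : V), u ∈ A.weight γ → weightClass γ = r → g (A.mode u n v) = 0) {u : V}
    (hu : u ∈ A.classSpace r) : g (A.mode u n v) = 0 := by
  induction hu using Submodule.span_induction with
  | mem x hx => exact h _ x hx.choose_spec.1 hx.choose_spec.2
  | zero => simp [mode_zero_left]
  | add x y _ _ hx hy =>
    have : A.mode (x + y) n v = A.mode x n v + A.mode y n v := by simp [VertexAlgebra.mode]
    rw [this, map_add, hx, hy, add_zero]
  | smul c x _ hx =>
    have : A.mode (c • x) n v = c • A.mode x n v := by simp [VertexAlgebra.mode]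
    rw [this, map_smul, hx, smul_zero]

theorem C_le_ker_f (h0 : A.classSpace 0 = ⨆ n : ℕ, A.weight (n : ℂ)) :
    A.C ≤ LinearMap.ker A.f := by
  refine Submodule.span_le.2 ?_
  rintro x ((⟨r, hr, hx⟩ | ⟨u, v, hu, rfl⟩) | ⟨r, b, w, hr, hb, rfl⟩)
  · refine (Submodule.span_le (p := LinearMap.ker A.f)).2 ?_ hx
    rintro a ⟨γ, ha, rfl⟩
    refine A.f_eq_zero_of_forall_ne_natCast (fun k hk => hr ?_) ha
    rw [hk, weightClass_natCast]
  · refine A.classSpace_le_ker_mode A.f 0 (-2) v (fun γ u hu hγ => ?_) hu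
    have := A.f_mode h0 hu v
    rwa [classDelta, if_pos hγ] at this
  · refine A.classSpace_le_ker_mode A.f r (-1) w (fun γ u hu hγ => ?_) hb
    have := A.f_mode h0 hu w
    rwa [classDelta, if_neg (hγ ▸ hr), add_zero] at this

/-! ### Comparison of `A(V)` with `gr A(V)` -/

/-- Vectors of non-integral weight lie in `O(V)`, since `u ∘ 𝟏 = u` for these. -/
theorem weight_le_O {γ : ℂ} (hγ : weightClass γ ≠ 0) : A.weight γ ≤ A.O := by
  intro u hu
  -- `S = ⊥` works because `δ = 0`: the correction terms are `u_n 𝟏` with `n ≥ 0`, all zero.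
  have h := A.residue_sub_mode_mem (S := ⊥) (⌈γ.re⌉ + classDelta γ - 1) (1 + classDelta γ) u A.vac
    fun n hn => (Submodule.mem_bot ℂ).2 (A.creation_nonneg u n (by
      rw [classDelta, if_neg hγ] at hn
      omega))
  rw [← A.circ_of_mem_weight hu, Submodule.mem_bot, sub_eq_zero, classDelta, if_neg hγ,
    add_zero] at h
  exact Submodule.subset_span ⟨u, A.vac, (h.trans (A.creation_neg_one u)).symm⟩

theorem iSup_filtration (h0 : A.classSpace 0 = ⨆ n : ℕ, A.weight (n : ℂ)) :
    ⨆ k : ℕ, A.filtration k = ⊤ := by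
  rw [eq_top_iff, ← Submodule.range_mkQ A.O, ← Submodule.map_top, ← A.iSup_weight,
    Submodule.map_iSup]
  refine iSup_le fun γ => ?_
  by_cases hγ : weightClass γ = 0
  · obtain ⟨m, rfl⟩ := (weightClass_eq_zero_iff γ).1 hγ
    exact le_iSup_of_le m.toNat
      (Submodule.map_mono (A.weight_intCast_le_iSup h0 (Int.self_le_toNat m)))
  · rintro _ ⟨u, hu, rfl⟩
    have : A.O.mkQ u = 0 := (Submodule.Quotient.mk_eq_zero _).2 (A.weight_le_O hγ hu)
    rw [this]
    exact zero_mem _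

theorem filtration_of_neg {t : ℤ} (ht : t < 0) : A.filtration t = ⊥ := by
  rw [filtration, ← Submodule.map_bot A.O.mkQ]
  congr 1
  refine le_bot_iff.mp (iSup₂_le fun j hj => ?_)
  omega

/-- Splitting the filtration gives a linear epimorphism `gr A(V) → A(V)`. -/
theorem exists_grZhu_surjective (h0 : A.classSpace 0 = ⨆ n : ℕ, A.weight (n : ℂ)) :
    ∃ g : A.grZhu →ₗ[ℂ] A.Zhu, Function.Surjective g := by
  have hsec : ∀ t : ℕ, ∃ s : A.gr t →ₗ[ℂ] A.filtration t,
      ((A.filtration ((t : ℤ) - 1)).submoduleOf (A.filtration t)).mkQ ∘ₗ s = LinearMap.id :=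
    fun t => LinearMap.exists_rightInverse_of_surjective _ (Submodule.range_mkQ _)
  choose s hs using hsec
  refine ⟨DirectSum.toModule ℂ ℕ A.Zhu fun t => (A.filtration t).subtype ∘ₗ s t, ?_⟩
  set g := DirectSum.toModule ℂ ℕ A.Zhu fun t => (A.filtration t).subtype ∘ₗ s t with hg
  rw [← LinearMap.range_eq_top, eq_top_iff, ← A.iSup_filtration h0]
  -- An element of `F_t` differs from the chosen lift of its symbol by an element of `F_{t-1}`; the
  -- induction starts from `F_{-1} = 0`.
  have hstep : ∀ t : ℕ, A.filtration ((t : ℤ) - 1) ≤ LinearMap.range g →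
      A.filtration t ≤ LinearMap.range g := by
    intro t ht x hx
    set y : A.gr t := Submodule.Quotient.mk ⟨x, hx⟩ with hy
    have hsy : (Submodule.Quotient.mk (s t y) : A.gr t) = y := LinearMap.congr_fun (hs t) y
    have hdiff : x - (s t y : A.Zhu) ∈ A.filtration ((t : ℤ) - 1) :=
      (Submodule.Quotient.eq ((A.filtration ((t : ℤ) - 1)).submoduleOf (A.filtration t))).1
        (hy.symm.trans hsy.symm)
    have hgy : g (DirectSum.lof ℂ ℕ A.gr t y) = (s t y : A.Zhu) := by
      rw [hg, DirectSum.toModule_lof]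
      rfl
    have := add_mem (ht hdiff) (hgy ▸ LinearMap.mem_range_self g _)
    rwa [sub_add_cancel] at this
  refine iSup_le fun t => ?_
  induction t with
  | zero => exact hstep 0 (by rw [A.filtration_of_neg (by simp)]; exact bot_le)
  | succ t ih => exact hstep (t + 1) (by simpa using ih)

/-- Over a field, a linear map to a module that is only an additive monoid descends to the quotient
by a subspace of its kernel. -/
theorem exists_comp_mkQ_eq {W : Type*} [AddCommMonoid W] [Module ℂ W] (S : Submodule ℂ V)
    (g : V →ₗ[ℂ] W) (h : ∀ x ∈ S, g x = 0) : ∃ gbar : (V ⧸ S) →ₗ[ℂ] W, gbar ∘ₗ S.mkQ = g := by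
  obtain ⟨s, hs⟩ := LinearMap.exists_rightInverse_of_surjective S.mkQ (Submodule.range_mkQ S)
  refine ⟨g ∘ₗ s, LinearMap.ext fun x => ?_⟩
  have hmem : s (S.mkQ x) - x ∈ S :=
    (Submodule.Quotient.eq S).1 (LinearMap.congr_fun hs (S.mkQ x))
  calc g (s (S.mkQ x)) = g (s (S.mkQ x) - x + x) := by rw [sub_add_cancel]
    _ = g x := by rw [map_add, h _ hmem, zero_add]

theorem exists_quotient_C_surjective (h0 : A.classSpace 0 = ⨆ n : ℕ, A.weight (n : ℂ)) :
    ∃ fbar : (V ⧸ A.C) →ₗ[ℂ] A.grZhu, fbar ∘ₗ A.C.mkQ = A.f ∧ Function.Surjective fbar := by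
  obtain ⟨fbar, hfbar⟩ := exists_comp_mkQ_eq A.C A.f fun x hx => A.C_le_ker_f h0 hx
  refine ⟨fbar, hfbar, fun y => ?_⟩
  obtain ⟨u, hu⟩ := A.f_surjective y
  exact ⟨A.C.mkQ u, (LinearMap.congr_fun hfbar u).trans hu⟩

theorem rank_Zhu_le (h0 : A.classSpace 0 = ⨆ n : ℕ, A.weight (n : ℂ)) :
    Module.rank ℂ A.Zhu ≤ Module.rank ℂ (V ⧸ A.C) := by
  obtain ⟨fbar, -, hfbar⟩ := A.exists_quotient_C_surjective h0
  obtain ⟨g, hg⟩ := A.exists_grZhu_surjective h0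
  exact LinearMap.rank_le_of_surjective (g ∘ₗ fbar) (hg.comp hfbar)

end CGradedVertexAlgebra

theorem theorem5p3 {V : Type*} [AddCommGroup V] [Module ℂ V] (A : CGradedVertexAlgebra V)
    (hA : A.IsOmegaGeneratedRePos)
    (h0 : A.classSpace 0 = ⨆ n : ℕ, A.weight (n : ℂ)) :
    Function.Surjective A.f ∧
      A.C ≤ LinearMap.ker A.f ∧
      (∃ fbar : (V ⧸ A.C) →ₗ[ℂ] A.grZhu,
        fbar ∘ₗ A.C.mkQ = A.f ∧ Function.Surjective fbar) ∧
      Module.rank ℂ A.Zhu ≤ Module.rank ℂ (V ⧸ A.C) := by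
  exact ⟨A.f_surjective, A.C_le_ker_f h0, A.exists_quotient_C_surjective h0, A.rank_Zhu_le h0⟩
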